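/- Consider circuits with all-to-all connectivity whose elementary gates are CNOTs (on any ordered pair of distinct qubits) and single-qubit unitaries. For a kind $p$ of gates, the $p$-cost of a circuit is the number of its gates of kind $p$, and its $p$-depth is the largest number of gates of kind $p$ along a chain of gates in which each gate shares a qubit with the next one (equivalently, the least number of time slots that contain gates of kind $p$, when gates sharing a qubit occupy different slots and keep their order). The multi-controlled multi-target $X$ gate with control set $C$ and targets $t_1,\dots,t_m$ is the product of the multi-controlled $X$ (MCX) gates with control set $C$ and target $t_j$, $1\le j\le m$. All implementations are exact. **Theorem.** Let $n\ge 5$ and $m\ge 2$. The multi-controlled multi-target $X$ gate with $n$ controls and $m$ targets can be implemented without ancilla, that is, by a circuit on these $n+m$ qubits only, over the gate set $\{\mathrm{CNOT},H,T,T^\dagger\}$. Moreover, it can be implemented without ancilla at the costs and depths of an MCX gate with $n$ controls and one dirty ancilla, up to an increase of $2(m-1)$ in CNOT cost and of $2\lceil\log_2 m\rceil$ in CNOT depth. Precisely: let $D$ be any circuit on $n+2$ qubits that implements the MCX gate with $n$ controls and one target, the remaining qubit being a dirty ancilla (it may be in any state, and is left unchanged). Then there is a circuit $E$ on the $n+m$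 qubits that implements the multi-controlled multi-target $X$ gate and satisfies: 1. $E$ contains $D$ as a block of consecutive gates, acting on the $n$ controls, with one of the $m$ targets in the role of the target of $D$ and another one in the role of its dirty ancilla; 2. the CNOT cost of $E$ is the CNOT cost of $D$ plus $2(m-1)$; 3. the CNOT depth of $E$ is at most the CNOT depth of $D$ plus $2\lceil\log_2 m\rceil$; 4. for every set $K$ of single-qubit gates (for instance $\{T,T^\dagger\}$, $\{H\}$, or the rotations $R_x,R_z$), the $K$-cost and the $K$-depth of $E$ are equal to those of $D$. -/

import Mathlib

namespace QCircuit

open Matrix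

/-- The Pauli `X` matrix. -/
def pauliX : Matrix (Fin 2) (Fin 2) ℂ := !![0, 1; 1, 0]

/-- The Hadamard matrix. -/
noncomputable def hadamard : Matrix (Fin 2) (Fin 2) ℂ :=
  ((Real.sqrt 2 : ℝ) : ℂ)⁻¹ • !![1, 1; 1, -1]

/-- The `T` matrix `diag (1, exp (i π / 4))`. -/
noncomputable def tMatrix : Matrix (Fin 2) (Fin 2) ℂ :=
  !![1, 0; 0, Complex.exp (Complex.I * (Real.pi / 4))]

/-- Operators on the state space of the qubit register `Q`, as matrices in the computational
basis, whose vectors are labelled by the functions `Q → Fin 2`. -/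
abbrev Operator (Q : Type) : Type := Matrix (Q → Fin 2) (Q → Fin 2) ℂ

section

variable {Q : Type} [Fintype Q] [DecidableEq Q]

/-- The operator that applies the `2 × 2` matrix `U` to the qubit `t` when all the qubits in `C`
are in the state `1`, and the identity otherwise; it is used for `t ∉ C` only. -/
def controlled (C : Finset Q) (t : Q) (U : Matrix (Fin 2) (Fin 2) ℂ) : Operator Q :=
  fun x y =>
    if ∀ r, r ≠ t → x r = y r then
      (if ∀ c ∈ C, y c = 1 then U (x t) (y t) else (1 : Matrix (Fin 2) (Fin 2) ℂ) (x t) (y t))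
    else 0

/-- The multi-controlled `X` gate with control set `C` and target `t` (the identity on all the
other qubits of the register). -/
def mcx (C : Finset Q) (t : Q) : Operator Q := controlled C t pauliX

/-- The multi-controlled multi-target `X` gate: the product of the multi-controlled `X` gates with
the common control set `C` and the targets `ts 0, …, ts (m - 1)`. -/
def mcmtx {m : ℕ} (C : Finset Q) (ts : Fin m → Q) : Operator Q :=
  (List.ofFn fun j => mcx C (ts j)).prod

end

/-- The elementary gates on a register `Q` with all-to-all connectivity: a CNOT on any ordered pair
of distinct qubits (control first), and any single-qubit unitary on any qubit. -/
inductive Gate (Q : Type) : Type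
  | cnot (c t : Q) (h : c ≠ t) : Gate Q
  | single (U : Matrix.unitaryGroup (Fin 2) ℂ) (q : Q) : Gate Q

/-- A circuit is a list of gates, the first gate of the list being applied first. -/
abbrev Circuit (Q : Type) : Type := List (Gate Q)

namespace Gate

variable {Q R : Type}

/-- The operator that a gate implements. -/
def toOperator [Fintype Q] [DecidableEq Q] : Gate Q → Operator Q
  | cnot c t _ => controlled {c} t pauliX
  | single U q => controlled ∅ q (U : Matrix (Fin 2) (Fin 2) ℂ)

/-- The qubits a gate acts on. -/
def qubits [DecidableEq Q] : Gate Q → Finset Q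
  | cnot c t _ => {c, t}
  | single _ q => {q}

/-- The gate is a CNOT. -/
def IsCNOT : Gate Q → Prop
  | cnot _ _ _ => True
  | single _ _ => False

/-- The gate is a single-qubit gate whose matrix lies in `K`. -/
def IsSingleIn (K : Set (Matrix (Fin 2) (Fin 2) ℂ)) : Gate Q → Prop
  | cnot _ _ _ => False
  | single U _ => (U : Matrix (Fin 2) (Fin 2) ℂ) ∈ K

/-- The gate is one of CNOT, `H`, `T`, `T†`. -/
def IsCliffordT (g : Gate Q) : Prop :=
  g.IsCNOT ∨ g.IsSingleIn {hadamard, tMatrix, tMatrixᴴ}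

/-- The same gate on another register, its qubits being renamed by `f`. -/
def map (f : Q ↪ R) : Gate Q → Gate R
  | cnot c t h => cnot (f c) (f t) (f.injective.ne h)
  | single U q => single U (f q)

end Gate

namespace Circuit

variable {Q : Type} [Fintype Q] [DecidableEq Q]

/-- The operator that a circuit implements (exactly, global phase included). -/
def eval : Circuit Q → Operator Q
  | [] => 1
  | g :: c => eval c * g.toOperator

open Classical in
/-- The cost of a circuit in gates of kind `p`: the number of these gates. -/
noncomputable def cost (p : Gate Q → Prop) (c : Circuit Q) : ℕ :=
  c.countP fun g => decide (p g)

open Classical in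
/-- Update, by one more gate, of the record that holds for every qubit `q` the largest number of
gates of kind `p` along a chain of successively dependent gates that ends on `q`; two gates depend
on each other when they share a qubit. -/
noncomputable def step (p : Gate Q → Prop) (σ : Q → ℕ) (g : Gate Q) : Q → ℕ :=
  fun q => if q ∈ g.qubits then g.qubits.sup σ + (if p g then 1 else 0) else σ q

/-- The depth of a circuit in gates of kind `p`: the largest number of gates of kind `p` along a
chain of gates each of which shares a qubit with its successor, equivalently the least number of
time slots that contain gates of kind `p`, over all ways to put the gates into time slots such that
gates that share a qubit are in different slots and keep their order. -/
noncomputable def depth (p : Gate Q → Prop) (c : Circuit Q) : ℕ :=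
  Finset.univ.sup (c.foldl (step p) fun _ => 0)

end Circuit

/-- The set of the `n` control qubits in a register of `n` control qubits and further qubits. -/
def controls (n k : ℕ) : Finset (Fin n ⊕ Fin k) := Finset.univ.map Function.Embedding.inl

/-- The circuit `D`, on `n` control qubits, the qubit `inr 0` and the qubit `inr 1`, implements the
multi-controlled `X` gate with `n` controls and target `inr 0`, with `inr 1` as a dirty ancilla:
whatever the state of that qubit, it is left unchanged. -/
def ImplementsMCX (n : ℕ) (D : Circuit (Fin n ⊕ Fin 2)) : Prop :=
  Circuit.eval D = mcx (controls n 2) (Sum.inr 0)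

/-- The circuit `E`, on `n` control qubits, `m` target qubits and no other qubit, implements the
multi-controlled multi-target `X` gate. -/
def ImplementsMCMTX (n m : ℕ) (E : Circuit (Fin n ⊕ Fin m)) : Prop :=
  Circuit.eval E = mcmtx (controls n m) Sum.inr

/-- The injection of the register of an MCX circuit with one dirty ancilla into the register of a
multi-target gate that keeps the controls and sends the MCX target to the target `w 0` and the
dirty ancilla to the target `w 1`. -/
def place {m : ℕ} (n : ℕ) (w : Fin 2 ↪ Fin m) : Fin n ⊕ Fin 2 ↪ Fin n ⊕ Fin m :=
  (Function.Embedding.refl (Fin n)).sumMap w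

end QCircuit

/-!
Conjugation by a CNOT copies a bit flip on its control onto its target. Conjugating an MCX gate by
the CNOTs that copy its target onto the other `m - 1` targets therefore gives the multi-target gate
(`eval_fanOut_conj`). One of the targets that the MCX gate does not act on is free to serve as its
dirty ancilla.

In the conjugating circuit `fanOut`, the target `i` is copied from the target whose index is `i`
without its leading binary digit. Its gates fall into layers according to the binary length of `i`,
and gates of the same layer share no qubit, so that the CNOT depth is at most `⌈log₂ m⌉`
(`depth_fanOut_le`, by way of `Circuit.depth_map_le_of_slots`). Depth is subadditive under
concatenation, and CNOTs before and after a circuit affect neither the cost nor the depth in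
single-qubit gates (`Circuit.depth_append_append_of_forall_not`).

For the gate set CNOT, `H`, `T`, `T†`, it remains to implement one MCX gate with a dirty ancilla
(`isCliffordTImplementable_mcx`). The Toffoli gate is a doubly controlled `Z` conjugated by `H`, and
the doubly controlled `Z` is a product of phases `T`, `T†` on parities of its bits
(`bitPhase_parities`). An MCX gate with more controls alternates two Toffoli gates onto the dirty
ancilla with two smaller MCX gates controlled by it (`mcx_eq_of_dirty`); a control that the smaller
gate does not use is its dirty ancilla.

Operators that permute the computational basis are written as `basisMap f`, and those of MCX type as
the `basisMap` of a `controlledShift`, where bits are added modulo 2 in `Fin 2`.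
-/

/-! ### Operators that permute the computational basis, and larger registers -/

namespace QCircuit

open Matrix

section Operators

variable {Q R : Type} [Fintype Q] [DecidableEq Q] [Fintype R] [DecidableEq R]

/-- The operator that sends the basis vector labelled `y` to the one labelled `f y`. -/
def basisMap (f : (Q → Fin 2) → Q → Fin 2) : Operator Q :=
  fun x y => if x = f y then 1 else 0

/-- The map of bit strings that adds `v` (bitwise, modulo 2) to those that are `1` on all of `C`. -/
def controlledShift (C : Finset Q) (v y : Q → Fin 2) : Q → Fin 2 :=
  if ∀ c ∈ C, y c = 1 then y + v else y

lemma basisMap_mul (f g : (Q → Fin 2) → Q → Fin 2) :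
    basisMap f * basisMap g = basisMap (f ∘ g) := by
  ext x y
  simp [basisMap, Matrix.mul_apply]

omit [DecidableEq Q] in
lemma basisMap_id : basisMap (id : (Q → Fin 2) → Q → Fin 2) = 1 := by
  ext x y
  simp [basisMap, Matrix.one_apply]

lemma fin_two_add_self (a : Fin 2) : a + a = 0 := by revert a; decide

lemma controlled_pauliX (C : Finset Q) (t : Q) :
    controlled C t pauliX = basisMap (controlledShift C (Pi.single t 1)) := by
  ext x y
  have key : ∀ b : Fin 2, (x = y + Pi.single t b ↔ (∀ r, r ≠ t → x r = y r) ∧ x t = y t + b) := by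
    intro b
    constructor
    · rintro rfl
      exact ⟨fun r hr => by simp [hr], by simp⟩
    · rintro ⟨h, ht⟩
      funext r
      by_cases hr : r = t
      · subst hr; simpa using ht
      · simpa [hr] using h r hr
  have key0 := key 0
  rw [Pi.single_zero, add_zero, add_zero] at key0
  have hX : ∀ a b : Fin 2, pauliX a b = if a = b + 1 then 1 else 0 := by
    intro a b
    fin_cases a <;> fin_cases b <;> simp [pauliX]
  unfold controlled basisMap controlledShift
  by_cases hC : ∀ c ∈ C, y c = 1
  · simp only [if_pos hC, key 1, hX, ite_and]
  · simp only [if_neg hC, key0, Matrix.one_apply, ite_and]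

lemma mcx_eq_basisMap (C : Finset Q) (t : Q) :
    mcx C t = basisMap (controlledShift C (Pi.single t 1)) :=
  controlled_pauliX C t

lemma basisMap_controlledShift_mul (C : Finset Q) {v w : Q → Fin 2} (hw : ∀ c ∈ C, w c = 0) :
    basisMap (controlledShift C v) * basisMap (controlledShift C w) =
      basisMap (controlledShift C (v + w)) := by
  rw [basisMap_mul]
  congr 1
  funext y
  have h : (∀ c ∈ C, (y + w) c = 1) ↔ ∀ c ∈ C, y c = 1 :=
    forall₂_congr fun c hc => by simp [hw c hc]
  by_cases hC : ∀ c ∈ C, y c = 1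
  · simp only [Function.comp, controlledShift, if_pos hC, if_pos (h.2 hC)]
    abel
  · simp only [Function.comp, controlledShift, if_neg hC]

lemma mcmtx_eq_basisMap {m : ℕ} (C : Finset Q) (ts : Fin m → Q) (h : ∀ j, ts j ∉ C) :
    mcmtx C ts = basisMap (controlledShift C (∑ j, Pi.single (ts j) 1)) := by
  induction m with
  | zero =>
    have : controlledShift C (0 : Q → Fin 2) = id := by
      funext y; simp [controlledShift]
    simp [mcmtx, this, basisMap_id]
  | succ m ih =>
    have hsum : ∀ c ∈ C, (∑ j : Fin m, Pi.single (ts j.succ) (1 : Fin 2) : Q → Fin 2) c = 0 := by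
      intro c hc
      rw [Finset.sum_apply]
      refine Finset.sum_eq_zero fun j _ => ?_
      exact Pi.single_eq_of_ne (fun e : c = ts j.succ => h j.succ (e ▸ hc)) _
    have := ih (fun j => ts j.succ) fun j => h j.succ
    rw [mcmtx] at this
    rw [mcmtx, List.ofFn_succ, List.prod_cons, this, mcx_eq_basisMap,
      basisMap_controlledShift_mul C hsum, Fin.sum_univ_succ]

lemma controlledShift_singleton {c t : Q} (y : Q → Fin 2) :
    controlledShift {c} (Pi.single t 1) y = y + Pi.single t (y c) := by
  have : y c = 1 ∨ y c = 0 := by generalize y c = a; revert a; decide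
  rcases this with h | h <;> simp [controlledShift, h]

/-- Conjugation by a CNOT copies the shift of its control qubit onto its target qubit. -/
lemma cnot_conj_basisMap_controlledShift {C : Finset Q} {c t : Q} (hct : c ≠ t) (ht : t ∉ C)
    (v : Q → Fin 2) :
    mcx {c} t * basisMap (controlledShift C v) * mcx {c} t =
      basisMap (controlledShift C (v + Pi.single t (v c))) := by
  rw [mcx_eq_basisMap, basisMap_mul, basisMap_mul]
  congr 1
  funext y
  simp only [Function.comp, controlledShift_singleton]
  have hiff : (∀ r ∈ C, (y + Pi.single t (y c) : Q → Fin 2) r = 1) ↔ ∀ r ∈ C, y r = 1 :=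
    forall₂_congr fun r hr => by
      rw [Pi.add_apply, Pi.single_eq_of_ne (fun e : r = t => ht (e ▸ hr)), add_zero]
  by_cases hC : ∀ r ∈ C, y r = 1
  · have hC' := hiff.2 hC
    rw [controlledShift, controlledShift, if_pos hC, if_pos hC']
    funext r
    by_cases hr : r = t
    · subst hr
      simp only [Pi.add_apply, Pi.single_eq_same, Pi.single_eq_of_ne hct, add_zero]
      generalize y r = p; generalize y c = q; generalize v r = s; generalize v c = u
      revert p q s u; decide
    · simp [hr]
  · have hC' := mt hiff.1 hC
    rw [controlledShift, controlledShift, if_neg hC, if_neg hC']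
    funext r
    by_cases hr : r = t
    · subst hr
      simp only [Pi.add_apply, Pi.single_eq_same, Pi.single_eq_of_ne hct, add_zero]
      rw [add_assoc, fin_two_add_self, add_zero]
    · simp [hr]

/-- The operator on the register `R` that acts as `A` on the qubits in the range of `f` and as the
identity on the others. -/
def extend (f : Q ↪ R) (A : Operator Q) : Operator R :=
  fun x y => if ∀ r ∉ Set.range f, x r = y r then A (x ∘ f) (y ∘ f) else 0

omit [DecidableEq Q] in
lemma extend_one (f : Q ↪ R) : extend f (1 : Operator Q) = 1 := by
  ext x y
  simp only [extend, Matrix.one_apply, ← ite_and]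
  congr 1
  refine propext ⟨fun ⟨h, h'⟩ => ?_, fun h => by subst h; simp⟩
  funext r
  by_cases hr : r ∈ Set.range f
  · obtain ⟨q, rfl⟩ := hr
    exact congrFun h' q
  · exact h r hr

lemma extend_mul (f : Q ↪ R) (A B : Operator Q) : extend f (A * B) = extend f A * extend f B := by
  ext x y
  rw [Matrix.mul_apply]
  simp only [extend]
  by_cases hxy : ∀ r ∉ Set.range f, x r = y r
  · rw [if_pos hxy, Matrix.mul_apply]
    -- Only the strings `z` that agree with `y` off the range of `f` contribute.
    have hext : ∀ u : Q → Fin 2, Function.extend f u y ∘ f = u :=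
      fun u => funext fun q => f.injective.extend_apply _ _ _
    refine Finset.sum_of_injOn (fun u => Function.extend f u y) ?_ (by simp) ?_ ?_
    · intro u _ v _ h
      have := congrArg (· ∘ f) h
      simpa only [hext] using this
    · intro z _ hz
      by_cases hzy : ∀ r ∉ Set.range f, z r = y r
      · refine absurd ⟨z ∘ f, by simp, ?_⟩ hz
        funext r
        by_cases hr : r ∈ Set.range f
        · obtain ⟨q, rfl⟩ := hr
          exact f.injective.extend_apply _ _ _
        · rw [hzy r hr]
          exact Function.extend_apply' _ _ _ hr
      · rw [if_neg hzy, mul_zero]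
    · intro u _
      have h : ∀ r ∉ Set.range f, Function.extend f u y r = y r :=
        fun r hr => Function.extend_apply' _ _ _ hr
      rw [if_pos h, if_pos fun r hr => (hxy r hr).trans (h r hr).symm, hext]
  · rw [if_neg hxy]
    symm
    refine Finset.sum_eq_zero fun z _ => ?_
    by_cases h1 : ∀ r ∉ Set.range f, x r = z r
    · rw [if_neg (c := ∀ r ∉ Set.range f, z r = y r), mul_zero]
      exact fun h2 => hxy fun r hr => (h1 r hr).trans (h2 r hr)
    · rw [if_neg h1, zero_mul]

lemma extend_controlled (f : Q ↪ R) (C : Finset Q) (t : Q) (U : Matrix (Fin 2) (Fin 2) ℂ) :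
    extend f (controlled C t U) = controlled (C.map f) (f t) U := by
  ext x y
  have h : (∀ r, r ≠ f t → x r = y r) ↔
      (∀ r ∉ Set.range f, x r = y r) ∧ ∀ q, q ≠ t → x (f q) = y (f q) := by
    constructor
    · exact fun h => ⟨fun r hr => h r fun e => hr ⟨t, e.symm⟩,
        fun q hq => h _ (f.injective.ne hq)⟩
    · rintro ⟨h1, h2⟩ r hr
      by_cases hrf : r ∈ Set.range f
      · obtain ⟨q, rfl⟩ := hrf
        exact h2 q fun e => hr (congrArg f e)
      · exact h1 r hrf
  simp only [extend, controlled, Finset.forall_mem_map, Function.comp_apply, h, ite_and]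
  rfl

namespace Circuit

lemma eval_append (c d : Circuit Q) : eval (c ++ d) = eval d * eval c := by
  induction c with
  | nil => simp [eval]
  | cons g c ih => simp [eval, ih, Matrix.mul_assoc]

lemma eval_map (f : Q ↪ R) (c : Circuit Q) : eval (c.map (Gate.map f)) = extend f (eval c) := by
  induction c with
  | nil => simp [eval, extend_one]
  | cons g c ih =>
    rw [List.map_cons, eval, eval, extend_mul, ih]
    cases g <;> simp [Gate.map, Gate.toOperator, extend_controlled]

end Circuit

end Operators

end QCircuit

/-! ### Cost and depth under concatenation and renaming -/

namespace QCircuit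

namespace Circuit

section Depth

variable {Q R : Type} [DecidableEq Q] [DecidableEq R]

lemma step_le_add {p : Gate Q → Prop} {σ τ : Q → ℕ} {b : ℕ} (h : ∀ q, σ q ≤ τ q + b)
    (g : Gate Q) (q : Q) : step p σ g q ≤ step p τ g q + b := by
  simp only [step]
  split_ifs
  · have : g.qubits.sup σ ≤ g.qubits.sup τ + b :=
      Finset.sup_le fun r hr => (h r).trans (Nat.add_le_add_right (Finset.le_sup hr) b)
    omega
  · have : g.qubits.sup σ ≤ g.qubits.sup τ + b :=
      Finset.sup_le fun r hr => (h r).trans (Nat.add_le_add_right (Finset.le_sup hr) b)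
    omega
  · exact h q

lemma foldl_step_le_add {p : Gate Q → Prop} {b : ℕ} (c : Circuit Q) {σ τ : Q → ℕ}
    (h : ∀ q, σ q ≤ τ q + b) (q : Q) :
    c.foldl (step p) σ q ≤ c.foldl (step p) τ q + b := by
  induction c generalizing σ τ with
  | nil => exact h q
  | cons g c ih => exact ih fun r => step_le_add h g r

lemma depth_append_le [Fintype Q] (p : Gate Q → Prop) (c d : Circuit Q) :
    depth p (c ++ d) ≤ depth p c + depth p d := by
  refine Finset.sup_le fun q _ => ?_
  rw [List.foldl_append, add_comm]
  refine (foldl_step_le_add (b := depth p c) (τ := fun _ => 0) d (fun r => ?_) q).trans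
    (Nat.add_le_add_right ?_ _)
  · rw [zero_add]
    exact Finset.le_sup (f := c.foldl (step p) fun _ => 0) (Finset.mem_univ r)
  · exact Finset.le_sup (f := d.foldl (step p) fun _ => 0) (Finset.mem_univ q)

/-- A circuit whose gates are put into the time slots `1, …, b`, in such a way that gates that share
a qubit are in different slots and keep their order, has depth at most `b`. -/
lemma depth_map_le_of_slots [Fintype Q] (p : Gate Q → Prop) {ι : Type*} (g : ι → Gate Q)
    (slot : ι → ℕ) {b : ℕ} (l : List ι) (hpos : ∀ i ∈ l, 0 < slot i) (hb : ∀ i ∈ l, slot i ≤ b)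
    (hl : l.Pairwise fun i j => ¬ Disjoint (g i).qubits (g j).qubits → slot i < slot j) :
    depth p (l.map g) ≤ b := by
  suffices H : ∀ σ : Q → ℕ, (∀ q, σ q ≤ b) → (∀ i ∈ l, ∀ q ∈ (g i).qubits, σ q < slot i) →
      ∀ q, (l.map g).foldl (step p) σ q ≤ b from
    Finset.sup_le fun q _ => H _ (fun _ => Nat.zero_le b) (fun i hi _ _ => hpos i hi) q
  clear hpos
  induction l with
  | nil => exact fun σ h _ => h
  | cons i l ih =>
    intro σ hσ hslot
    rw [List.pairwise_cons] at hl
    have hstep : ∀ q ∈ (g i).qubits, step p σ (g i) q ≤ slot i := by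
      intro q hq
      have hne : 0 < slot i := (Nat.zero_le _).trans_lt (hslot i (by simp) q hq)
      have : (g i).qubits.sup σ < slot i :=
        (Finset.sup_lt_iff hne).2 fun r hr => hslot i (by simp) r hr
      simp only [step, if_pos hq]
      split_ifs <;> omega
    refine ih (fun j hj => hb j (List.mem_cons_of_mem _ hj)) hl.2 _ (fun q => ?_) fun j hj q hq => ?_
    · by_cases hq : q ∈ (g i).qubits
      · exact (hstep q hq).trans (hb i (by simp))
      · simpa only [step, if_neg hq] using hσ q
    · by_cases hqi : q ∈ (g i).qubits
      · exact (hstep q hqi).trans_lt (hl.1 j hj (Finset.not_disjoint_iff.2 ⟨q, hqi, hq⟩))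
      · simpa only [step, if_neg hqi] using hslot j (List.mem_cons_of_mem _ hj) q hq

lemma qubits_map (f : Q ↪ R) (g : Gate Q) : (g.map f).qubits = g.qubits.map f := by
  cases g <;> simp [Gate.map, Gate.qubits]

lemma foldl_step_map {p : Gate Q → Prop} {p' : Gate R → Prop} {f : Q ↪ R}
    (hp : ∀ g : Gate Q, p' (g.map f) ↔ p g) (c : Circuit Q) {σ : Q → ℕ} {τ : R → ℕ}
    (h : ∀ q, τ (f q) = σ q) (h' : ∀ r ∉ Set.range f, τ r = 0) :
    (∀ q, (c.map (Gate.map f)).foldl (step p') τ (f q) = c.foldl (step p) σ q) ∧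
      ∀ r ∉ Set.range f, (c.map (Gate.map f)).foldl (step p') τ r = 0 := by
  obtain rfl : p = fun g => p' (g.map f) := funext fun g => (propext (hp g)).symm
  induction c generalizing σ τ with
  | nil => exact ⟨h, h'⟩
  | cons g c ih =>
    have hcomp : τ ∘ f = σ := funext h
    refine ih (fun q => ?_) fun r hr => ?_
    · simp only [step, qubits_map, Finset.mem_map', Finset.sup_map, hcomp, h]
    · have : r ∉ g.qubits.map f := fun hm => by
        obtain ⟨q, -, rfl⟩ := Finset.mem_map.1 hm
        exact hr ⟨q, rfl⟩
      simp only [step, qubits_map, if_neg this, h' r hr]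

lemma depth_map [Fintype Q] [Fintype R] {p : Gate Q → Prop} {p' : Gate R → Prop} {f : Q ↪ R}
    (hp : ∀ g : Gate Q, p' (g.map f) ↔ p g) (c : Circuit Q) :
    depth p' (c.map (Gate.map f)) = depth p c := by
  obtain ⟨h, h'⟩ := foldl_step_map hp c (σ := fun _ => 0) (τ := fun _ => 0) (fun _ => rfl)
    fun _ _ => rfl
  refine le_antisymm (Finset.sup_le fun r _ => ?_) (Finset.sup_le fun q _ => ?_)
  · by_cases hr : r ∈ Set.range f
    · obtain ⟨q, rfl⟩ := hr
      rw [h]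
      exact Finset.le_sup (f := c.foldl (step p) fun _ => 0) (Finset.mem_univ q)
    · rw [h' r hr]
      exact Nat.zero_le _
  · rw [← h]
    exact Finset.le_sup (f := (c.map (Gate.map f)).foldl (step p') fun _ => 0)
      (Finset.mem_univ (f q))

omit [DecidableEq Q] [DecidableEq R] in
lemma cost_map [Fintype Q] [Fintype R] {p : Gate Q → Prop} {p' : Gate R → Prop} {f : Q ↪ R}
    (hp : ∀ g : Gate Q, p' (g.map f) ↔ p g) (c : Circuit Q) :
    cost p' (c.map (Gate.map f)) = cost p c := by
  obtain rfl : p = fun g => p' (g.map f) := funext fun g => (propext (hp g)).symm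
  simp only [cost, List.countP_map, Function.comp_def]

lemma foldl_step_zero_of_forall_not {p : Gate Q → Prop} (c : Circuit Q) (hc : ∀ g ∈ c, ¬ p g) :
    c.foldl (step p) (fun _ => 0) = fun _ => 0 := by
  induction c with
  | nil => rfl
  | cons g c ih =>
    have : step p (fun _ => 0) g = fun _ => 0 := by
      funext q
      simp only [step, if_neg (hc g (by simp)), add_zero]
      split_ifs
      · exact Nat.eq_zero_of_le_zero (Finset.sup_le fun _ _ => le_rfl)
      · rfl
    rw [List.foldl_cons, this]
    exact ih fun k hk => hc k (List.mem_cons_of_mem _ hk)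

lemma sup_foldl_step_of_forall_not [Fintype Q] {p : Gate Q → Prop} (c : Circuit Q)
    (hc : ∀ g ∈ c, ¬ p g) (σ : Q → ℕ) :
    Finset.univ.sup (c.foldl (step p) σ) = Finset.univ.sup σ := by
  induction c generalizing σ with
  | nil => rfl
  | cons g c ih =>
    rw [List.foldl_cons, ih fun k hk => hc k (List.mem_cons_of_mem _ hk)]
    refine le_antisymm (Finset.sup_le fun q _ => ?_) (Finset.sup_mono_fun fun q _ => ?_)
    · simp only [step, if_neg (hc g (by simp)), add_zero]
      split_ifs
      · exact Finset.sup_mono (Finset.subset_univ _)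
      · exact Finset.le_sup (Finset.mem_univ q)
    · simp only [step, if_neg (hc g (by simp)), add_zero]
      split_ifs with hq
      · exact Finset.le_sup hq
      · exact le_rfl

/-- Gates of other kinds before and after a circuit do not change its depth: the ones before leave
the record of chain lengths at `0`, and the ones after only move the maximum around. -/
lemma depth_append_append_of_forall_not [Fintype Q] {p : Gate Q → Prop} {l r : Circuit Q}
    (hl : ∀ g ∈ l, ¬ p g) (hr : ∀ g ∈ r, ¬ p g) (c : Circuit Q) :
    depth p (l ++ c ++ r) = depth p c := by
  rw [depth, List.foldl_append, List.foldl_append, foldl_step_zero_of_forall_not l hl,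
    sup_foldl_step_of_forall_not r hr, depth]

omit [DecidableEq Q] in
lemma cost_append_append_of_forall_not [Fintype Q] {p : Gate Q → Prop} {l r : Circuit Q}
    (hl : ∀ g ∈ l, ¬ p g) (hr : ∀ g ∈ r, ¬ p g) (c : Circuit Q) :
    cost p (l ++ c ++ r) = cost p c := by
  simp only [cost, List.countP_append]
  rw [(List.countP_eq_zero (l := l)).2 fun g hg => by simpa using hl g hg,
    (List.countP_eq_zero (l := r)).2 fun g hg => by simpa using hr g hg, zero_add, add_zero]

end Depth

end Circuit

end QCircuit

/-! ### The fan-out circuit -/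

namespace QCircuit

open Matrix

section FanOut

variable {n m : ℕ}

/-- The source of the copy onto the target `i + 1` in the binary fan-out tree: the index `i + 1`
without its leading binary digit. -/
def fanOutSource (i : ℕ) : ℕ := i + 1 - 2 ^ Nat.log 2 (i + 1)

lemma fanOutSource_lt (i : ℕ) : fanOutSource i < i + 1 :=
  Nat.sub_lt i.succ_pos (by positivity)

/-- The CNOT that copies the target `fanOutSource i` onto the target `i + 1`. -/
def fanOutGate (n : ℕ) {i : ℕ} (h : i + 1 < m) : Gate (Fin n ⊕ Fin m) :=
  Gate.cnot (Sum.inr ⟨fanOutSource i, (fanOutSource_lt i).trans h⟩) (Sum.inr ⟨i + 1, h⟩)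
    fun e => (fanOutSource_lt i).ne (Fin.mk.inj_iff.1 (Sum.inr.inj e))

/-- The circuit of CNOTs that copies the target `0` onto the targets `1, …, k`. -/
def fanOut (n : ℕ) {k : ℕ} (h : k < m) : Circuit (Fin n ⊕ Fin m) :=
  List.ofFn fun i : Fin k => fanOutGate n (i := i) (by omega)

lemma isCNOT_of_mem_fanOut {k : ℕ} (h : k < m) : ∀ g ∈ fanOut n h, g.IsCNOT := by
  intro g hg
  obtain ⟨i, rfl⟩ := List.mem_ofFn.1 hg
  trivial

lemma fanOut_succ {k : ℕ} (h : k + 1 < m) :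
    fanOut n h = fanOut n (Nat.lt_of_succ_lt h) ++ [fanOutGate n h] := by
  rw [fanOut, List.ofFn_succ', List.concat_eq_append]
  rfl

/-- Conjugation by the fan-out circuit turns the shift of the target `0` into the shift of all the
targets `0, …, k`: the copies are conjugations by one CNOT after the other, each of which copies the
shift of a target that is already shifted onto a new one. -/
lemma eval_fanOut_conj (C : Finset (Fin n ⊕ Fin m)) (hC : ∀ j : Fin m, Sum.inr j ∉ C) (hm : 0 < m)
    {D : Circuit (Fin n ⊕ Fin m)} (hD : Circuit.eval D = mcx C (Sum.inr ⟨0, hm⟩)) {k : ℕ}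
    (h : k < m) :
    Circuit.eval ((fanOut n h).reverse ++ D ++ fanOut n h) =
      basisMap (controlledShift C (Sum.elim 0 fun j => if (j : ℕ) ≤ k then 1 else 0)) := by
  induction k with
  | zero =>
    have : (Sum.elim 0 fun j : Fin m => if (j : ℕ) ≤ 0 then 1 else 0 : Fin n ⊕ Fin m → Fin 2) =
        Pi.single (Sum.inr ⟨0, hm⟩) 1 := by
      funext q
      rcases q with q | q
      · simp
      · simp [Pi.single_apply, Fin.ext_iff]
    rw [this, ← mcx_eq_basisMap]
    simpa [fanOut] using hD
  | succ k ih =>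
    have hrw : (fanOut n h).reverse ++ D ++ fanOut n h =
        [fanOutGate n h] ++ ((fanOut n (Nat.lt_of_succ_lt h)).reverse ++ D ++
          fanOut n (Nat.lt_of_succ_lt h)) ++ [fanOutGate n h] := by
      simp [fanOut_succ]
    have hg : Circuit.eval [fanOutGate n h] =
        mcx {Sum.inr ⟨fanOutSource k, (fanOutSource_lt k).trans h⟩} (Sum.inr ⟨k + 1, h⟩) := by
      simp [Circuit.eval, fanOutGate, Gate.toOperator, mcx]
    rw [hrw, Circuit.eval_append, Circuit.eval_append, ih, hg, ← Matrix.mul_assoc,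
      cnot_conj_basisMap_controlledShift _ (hC _)]
    · congr 2
      funext q
      rcases q with q | q
      · simp
      · have hs : fanOutSource k ≤ k := Nat.lt_succ_iff.1 (fanOutSource_lt k)
        simp only [Pi.add_apply, Sum.elim_inr, hs, if_true, Pi.single_apply, Sum.inr.injEq,
          Fin.ext_iff]
        split_ifs <;> first | rfl | omega
    · intro e
      exact (fanOutSource_lt k).ne (Fin.mk.inj_iff.1 (Sum.inr.inj e))

/-- Two gates of the fan-out tree that share a qubit lie in different layers: in the layer `l`, the
sources are less than `2 ^ l`, the new copies are not, and both determine the gate. -/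
lemma log_lt_log_of_not_disjoint {i j : ℕ} (hi : i + 1 < m) (hj : j + 1 < m) (hij : i < j)
    (h : ¬ Disjoint (fanOutGate n hi).qubits (fanOutGate n hj).qubits) :
    Nat.log 2 (i + 1) < Nat.log 2 (j + 1) := by
  refine lt_of_le_of_ne (Nat.log_mono_right (by omega)) fun e => h ?_
  have h1 := Nat.pow_log_le_self 2 (Nat.succ_ne_zero i)
  have h2 := Nat.pow_log_le_self 2 (Nat.succ_ne_zero j)
  have h3 := Nat.lt_pow_succ_log_self one_lt_two (i + 1)
  have h4 := Nat.lt_pow_succ_log_self one_lt_two (j + 1)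
  simp only [Nat.succ_eq_add_one, pow_succ, e] at h1 h2 h3 h4
  simp only [fanOutGate, Gate.qubits, fanOutSource, Finset.disjoint_insert_left,
    Finset.disjoint_singleton_left, Finset.mem_insert, Finset.mem_singleton, Sum.inr.injEq,
    Fin.mk.injEq, e]
  omega

lemma log_succ_lt_clog {i : ℕ} (h : i + 1 < m) : Nat.log 2 (i + 1) < Nat.clog 2 m := by
  refine Nat.log_lt_of_lt_pow i.succ_ne_zero (h.trans_le ?_)
  exact Nat.le_pow_clog one_lt_two m

lemma fanOut_eq_map {k : ℕ} (h : k < m) : fanOut n h =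
    (List.finRange k).map fun i : Fin k =>
      fanOutGate n (i := i) (Nat.lt_of_le_of_lt i.isLt h) :=
  List.ofFn_eq_map

lemma depth_fanOut_le (p : Gate (Fin n ⊕ Fin m) → Prop) {k : ℕ} (h : k < m) :
    Circuit.depth p (fanOut n h) ≤ Nat.clog 2 m := by
  rw [fanOut_eq_map]
  refine Circuit.depth_map_le_of_slots p _ (fun i : Fin k => Nat.log 2 (i + 1) + 1) _
    (fun i _ => Nat.succ_pos _)
    (fun i _ => log_succ_lt_clog (Nat.lt_of_le_of_lt i.isLt h)) ?_
  refine (List.pairwise_lt_finRange k).imp ?_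
  intro i j hij hd
  exact Nat.succ_lt_succ (log_lt_log_of_not_disjoint _ _ hij hd)

lemma depth_reverse_fanOut_le (p : Gate (Fin n ⊕ Fin m) → Prop) {k : ℕ} (h : k < m) :
    Circuit.depth p (fanOut n h).reverse ≤ Nat.clog 2 m := by
  rw [fanOut_eq_map, ← List.map_reverse]
  have hlog : ∀ i : Fin k, Nat.log 2 ((i : ℕ) + 1) < Nat.clog 2 m :=
    fun i => log_succ_lt_clog (by omega)
  refine Circuit.depth_map_le_of_slots p _ (fun i : Fin k => Nat.clog 2 m - Nat.log 2 (i + 1)) _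
    (fun i _ => Nat.sub_pos_of_lt (hlog i)) (fun i _ => Nat.sub_le _ _) ?_
  rw [List.pairwise_reverse]
  refine (List.pairwise_lt_finRange k).imp ?_
  intro i j hij hd
  exact Nat.sub_lt_sub_left (hlog i)
    (log_lt_log_of_not_disjoint _ _ hij fun hd' => hd hd'.symm)

lemma cost_isCNOT_fanOut {k : ℕ} (h : k < m) : Circuit.cost Gate.IsCNOT (fanOut n h) = k := by
  rw [Circuit.cost, List.countP_eq_length.2 fun g hg => by simpa using isCNOT_of_mem_fanOut h g hg]
  simp [fanOut]

end FanOut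

section MultiTarget

variable {n m : ℕ}

/-- The embedding of the two qubits of an MCX circuit that are no controls as the targets `0` and
`1`. -/
def firstTwo (hm : 2 ≤ m) : Fin 2 ↪ Fin m := Fin.castLEEmb hm

/-- The multi-target circuit: an MCX circuit conjugated by the fan-out of its target. -/
def multiTarget (hm : 2 ≤ m) (D : Circuit (Fin n ⊕ Fin 2)) : Circuit (Fin n ⊕ Fin m) :=
  (fanOut n (Nat.sub_one_lt_of_lt hm)).reverse ++ D.map (Gate.map (place n (firstTwo hm))) ++
    fanOut n (Nat.sub_one_lt_of_lt hm)

lemma inr_notMem_controls {k : ℕ} (j : Fin k) : Sum.inr j ∉ controls n k := by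
  simp [controls]

lemma implementsMCMTX_multiTarget (hm : 2 ≤ m) {D : Circuit (Fin n ⊕ Fin 2)}
    (hD : ImplementsMCX n D) : ImplementsMCMTX n m (multiTarget hm D) := by
  have hmap : (controls n 2).map (place n (firstTwo hm)) = controls n m := by
    ext q
    rcases q with q | q <;> simp [controls, place]
  have hev : Circuit.eval (D.map (Gate.map (place n (firstTwo hm)))) =
      mcx (controls n m) (Sum.inr ⟨0, by omega⟩) := by
    rw [Circuit.eval_map, hD, mcx, extend_controlled, hmap]
    rfl
  rw [ImplementsMCMTX, multiTarget,
    eval_fanOut_conj _ inr_notMem_controls (by omega) hev,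
    mcmtx_eq_basisMap _ _ inr_notMem_controls]
  congr 2
  funext q
  rw [Finset.sum_apply]
  rcases q with q | q
  · simp
  · have : (q : ℕ) ≤ m - 1 := by omega
    simp [this, Pi.single_apply]

end MultiTarget

end QCircuit

/-! ### Implementation of MCX gates over CNOT, `H`, `T`, `T†` -/

namespace QCircuit

open Matrix

/-- The Pauli `Z` matrix. -/
def pauliZ : Matrix (Fin 2) (Fin 2) ℂ := !![1, 0; 0, -1]

/-- The phase `exp (i π / 4)` of the `T` gate. -/
noncomputable def tPhase : ℂ := Complex.exp (Complex.I * (Real.pi / 4))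

lemma tPhase_pow_four : tPhase ^ 4 = -1 := by
  rw [tPhase, ← Complex.exp_nat_mul, ← Complex.exp_pi_mul_I]
  congr 1
  push_cast
  ring

lemma star_tPhase_mul : star tPhase * tPhase = 1 := by
  have h : (Real.pi / 4 : ℂ) = ((Real.pi / 4 : ℝ) : ℂ) := by push_cast; rfl
  rw [tPhase, h, Complex.star_def, ← Complex.exp_conj, ← Complex.exp_add, map_mul, Complex.conj_I,
    Complex.conj_ofReal, neg_mul, neg_add_cancel, Complex.exp_zero]

lemma tMatrix_mem_unitaryGroup : tMatrix ∈ unitaryGroup (Fin 2) ℂ := by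
  have h : Complex.exp (Complex.I * (Real.pi / 4)) = tPhase := rfl
  rw [mem_unitaryGroup_iff', tMatrix, h, Matrix.star_eq_conjTranspose]
  ext i j
  have := star_tPhase_mul
  rw [Complex.star_def] at this
  fin_cases i <;> fin_cases j <;> simp [Matrix.mul_apply, this]

lemma sqrt_two_inv_mul_self :
    ((Real.sqrt 2 : ℝ) : ℂ)⁻¹ * ((Real.sqrt 2 : ℝ) : ℂ)⁻¹ = 2⁻¹ := by
  rw [← mul_inv, ← Complex.ofReal_mul, Real.mul_self_sqrt zero_le_two, Complex.ofReal_ofNat]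

lemma hadamard_mul_self : hadamard * hadamard = 1 := by
  rw [hadamard, smul_mul_smul_comm, sqrt_two_inv_mul_self]
  ext i j
  fin_cases i <;> fin_cases j <;> norm_num [Matrix.mul_apply]

lemma hadamard_mem_unitaryGroup : hadamard ∈ unitaryGroup (Fin 2) ℂ := by
  have : star hadamard = hadamard := by
    ext i j
    fin_cases i <;> fin_cases j <;> simp [hadamard]
  rw [mem_unitaryGroup_iff', this, hadamard_mul_self]

lemma hadamard_mul_pauliZ_mul_hadamard : hadamard * pauliZ * hadamard = pauliX := by
  rw [hadamard, smul_mul, smul_mul_smul_comm, sqrt_two_inv_mul_self]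
  ext i j
  fin_cases i <;> fin_cases j <;> norm_num [Matrix.mul_apply, pauliX, pauliZ]

section

variable {Q : Type} [Fintype Q] [DecidableEq Q]

/-- The operator is implemented, without further qubits, by a circuit over CNOT, `H`, `T`, `T†`. -/
def IsCliffordTImplementable (A : Operator Q) : Prop :=
  ∃ c : Circuit Q, Circuit.eval c = A ∧ ∀ g ∈ c, g.IsCliffordT

lemma IsCliffordTImplementable.mul {A B : Operator Q} (hA : IsCliffordTImplementable A)
    (hB : IsCliffordTImplementable B) : IsCliffordTImplementable (A * B) := by
  obtain ⟨a, rfl, ha⟩ := hA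
  obtain ⟨b, rfl, hb⟩ := hB
  refine ⟨b ++ a, Circuit.eval_append b a, fun g hg => ?_⟩
  exact (List.mem_append.1 hg).elim (hb g) (ha g)

lemma isCliffordTImplementable_cnot {c t : Q} (h : c ≠ t) :
    IsCliffordTImplementable (mcx {c} t) :=
  ⟨[Gate.cnot c t h], by simp [Circuit.eval, Gate.toOperator, mcx],
    by simp [Gate.IsCliffordT, Gate.IsCNOT]⟩

lemma isCliffordTImplementable_single {U : Matrix (Fin 2) (Fin 2) ℂ}
    (hU : U ∈ unitaryGroup (Fin 2) ℂ)
    (h : U ∈ ({hadamard, tMatrix, tMatrixᴴ} : Set (Matrix (Fin 2) (Fin 2) ℂ))) (q : Q) :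
    IsCliffordTImplementable (controlled ∅ q U) :=
  ⟨[Gate.single ⟨U, hU⟩ q], by simp [Circuit.eval, Gate.toOperator],
    by simpa [Gate.IsCliffordT, Gate.IsSingleIn, Gate.IsCNOT] using h⟩

/-- The operator that applies to the qubit `t` a matrix that may depend on the other qubits. -/
def uniformlyControlled (t : Q) (G : (Q → Fin 2) → Matrix (Fin 2) (Fin 2) ℂ) : Operator Q :=
  fun x y => if ∀ r, r ≠ t → x r = y r then G y (x t) (y t) else 0

lemma uniformlyControlled_mul (t : Q) {G : (Q → Fin 2) → Matrix (Fin 2) (Fin 2) ℂ}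
    (hG : ∀ y b, G (Function.update y t b) = G y) (H : (Q → Fin 2) → Matrix (Fin 2) (Fin 2) ℂ) :
    uniformlyControlled t G * uniformlyControlled t H =
      uniformlyControlled t fun y => G y * H y := by
  ext x y
  have hup : ∀ b, ∀ r, r ≠ t → Function.update y t b r = y r :=
    fun b r hr => Function.update_of_ne hr _ _
  -- Only the strings that agree with `y` off `t` contribute.
  have hsum : ∑ z, uniformlyControlled t G x z * uniformlyControlled t H z y =
      ∑ b : Fin 2, (if ∀ r, r ≠ t → x r = y r then G y (x t) b else 0) * H y b (y t) := by
    symm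
    refine Finset.sum_of_injOn (fun b => Function.update y t b) ?_ (by simp) ?_ ?_
    · exact fun a _ b _ h => Function.update_injective y t h
    · intro z _ hz
      rw [uniformlyControlled, uniformlyControlled, if_neg (c := ∀ r, r ≠ t → z r = y r), mul_zero]
      intro h
      refine hz ⟨z t, by simp, ?_⟩
      funext r
      by_cases hr : r = t
      · subst hr; simp
      · simp [hr, h r hr]
    · intro b _
      have h1 : (∀ r, r ≠ t → x r = Function.update y t b r) ↔ ∀ r, r ≠ t → x r = y r :=
        forall₂_congr fun r hr => by rw [hup b r hr]
      simp only [uniformlyControlled, h1, if_pos (hup b), hG, Function.update_self]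
  rw [Matrix.mul_apply, hsum, uniformlyControlled]
  split_ifs <;> simp [Matrix.mul_apply]

lemma controlled_eq_uniformlyControlled (C : Finset Q) (t : Q) (U : Matrix (Fin 2) (Fin 2) ℂ) :
    controlled C t U = uniformlyControlled t fun y => if ∀ c ∈ C, y c = 1 then U else 1 := by
  ext x y
  simp only [controlled, uniformlyControlled]
  split_ifs <;> rfl

lemma controlled_empty_mul_controlled_mul (C : Finset Q) {t : Q} (ht : t ∉ C)
    {U V W : Matrix (Fin 2) (Fin 2) ℂ} (hUW : U * W = 1) :
    controlled ∅ t U * controlled C t V * controlled ∅ t W = controlled C t (U * V * W) := by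
  have hinv : ∀ (y : Q → Fin 2) b, (∀ c ∈ C, Function.update y t b c = 1) ↔ ∀ c ∈ C, y c = 1 :=
    fun y b => forall₂_congr fun c hc => by
      rw [Function.update_of_ne (fun e : c = t => ht (e ▸ hc))]
  simp only [controlled_eq_uniformlyControlled]
  rw [uniformlyControlled_mul t (by simp), uniformlyControlled_mul t (by simp [hinv])]
  congr 1
  funext y
  by_cases hC : ∀ c ∈ C, y c = 1
  · simp [if_pos hC]
  · simp [if_neg hC, hUW]

lemma controlled_diag (C : Finset Q) (t : Q) (u : ℂ) :
    controlled C t !![1, 0; 0, u] =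
      diagonal fun y => if (∀ c ∈ C, y c = 1) ∧ y t = 1 then u else 1 := by
  have hd : ∀ a b : Fin 2, (!![1, 0; 0, u] : Matrix (Fin 2) (Fin 2) ℂ) a b =
      if a = b then (if b = 1 then u else 1) else 0 := by
    intro a b
    fin_cases a <;> fin_cases b <;> simp
  ext x y
  have hxy : x = y ↔ (∀ r, r ≠ t → x r = y r) ∧ x t = y t := by
    refine ⟨by rintro rfl; simp, fun ⟨h, ht⟩ => funext fun r => ?_⟩
    by_cases hr : r = t
    · subst hr; exact ht
    · exact h r hr
  rw [diagonal_apply, controlled]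
  simp only [hd, Matrix.one_apply]
  by_cases h : x = y
  · subst h
    simp only [implies_true, if_true]
    split_ifs <;> simp_all
  · rw [if_neg h]
    have := mt hxy.2 h
    split_ifs <;> simp_all

lemma basisMap_mul_diagonal_mul_basisMap {f : (Q → Fin 2) → Q → Fin 2}
    (hf : Function.Involutive f) (φ : (Q → Fin 2) → ℂ) :
    basisMap f * diagonal φ * basisMap f = diagonal (φ ∘ f) := by
  ext x y
  rw [Matrix.mul_apply]
  simp only [Matrix.mul_diagonal, basisMap, mul_ite, mul_one, mul_zero, Finset.sum_ite_eq',
    Finset.mem_univ, if_true, hf y, diagonal_apply, Function.comp]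
  split_ifs with h
  · rw [h, one_mul]
  · rw [zero_mul]

/-- Conjugation by a CNOT adds the control bit to the target bit in the phases of a diagonal
operator. -/
lemma IsCliffordTImplementable.diagonal_comp_cnot {φ : (Q → Fin 2) → ℂ}
    (h : IsCliffordTImplementable (diagonal φ)) {c t : Q} (hct : c ≠ t) :
    IsCliffordTImplementable (diagonal fun y => φ (y + Pi.single t (y c))) := by
  have hcnot : controlledShift {c} (Pi.single t 1) = fun y : Q → Fin 2 => y + Pi.single t (y c) :=
    funext controlledShift_singleton
  have hinv : Function.Involutive (controlledShift {c} (Pi.single t (1 : Fin 2))) := by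
    intro y
    rw [hcnot]
    funext r
    by_cases hr : r = t
    · subst hr
      simp [Pi.single_eq_of_ne hct, add_assoc, fin_two_add_self]
    · simp [hr]
  have := ((isCliffordTImplementable_cnot hct).mul h).mul (isCliffordTImplementable_cnot hct)
  rw [mcx_eq_basisMap, basisMap_mul_diagonal_mul_basisMap hinv, hcnot] at this
  exact this

/-- The phase that `diag (1, u)` gives to the bit `a`. -/
noncomputable def bitPhase (u : ℂ) (a : Fin 2) : ℂ := if a = 1 then u else 1

lemma isCliffordTImplementable_bitPhase (q : Q) :
    IsCliffordTImplementable (diagonal fun y : Q → Fin 2 => bitPhase tPhase (y q)) := by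
  have := isCliffordTImplementable_single tMatrix_mem_unitaryGroup (by simp) q
  rw [tMatrix, controlled_diag] at this
  simpa [bitPhase, tPhase] using this

lemma isCliffordTImplementable_bitPhase_star (q : Q) :
    IsCliffordTImplementable (diagonal fun y : Q → Fin 2 => bitPhase (star tPhase) (y q)) := by
  have hT : tMatrixᴴ = !![1, 0; 0, star tPhase] := by
    ext i j
    fin_cases i <;> fin_cases j <;> simp [tMatrix, tPhase]
  have hU : tMatrixᴴ ∈ unitaryGroup (Fin 2) ℂ := Unitary.star_mem tMatrix_mem_unitaryGroup
  have := isCliffordTImplementable_single hU (by simp) q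
  rw [hT, controlled_diag] at this
  simpa [bitPhase] using this

/-- The phase polynomial of the doubly controlled `Z` gate: `4abc` is the signed sum of the parities
of the nonempty sets of the bits `a`, `b`, `c`, and the fourth power of the phase of `T` is `-1`. -/
lemma bitPhase_parities (a b c : Fin 2) :
    bitPhase tPhase a * bitPhase tPhase b * bitPhase tPhase c * bitPhase (star tPhase) (b + a) *
      bitPhase (star tPhase) (c + a) * bitPhase (star tPhase) (c + b) *
        bitPhase tPhase (c + b + a) = if a = 1 ∧ b = 1 ∧ c = 1 then -1 else 1 := by
  have h := star_tPhase_mul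
  have h4 := tPhase_pow_four
  generalize star tPhase = v at *
  generalize tPhase = u at *
  have h11 : (1 : Fin 2) + 1 = 0 := rfl
  fin_cases a <;> fin_cases b <;> fin_cases c <;> simp [bitPhase, h11] <;>
    first | linear_combination (v * u + 1) * h | linear_combination h4

lemma isCliffordTImplementable_ccx {a b t : Q} (hab : a ≠ b) (hat : a ≠ t) (hbt : b ≠ t) :
    IsCliffordTImplementable (mcx {a, b} t) := by
  have hT := fun q : Q => isCliffordTImplementable_bitPhase q
  have hT' := fun q : Q => isCliffordTImplementable_bitPhase_star q
  have hccz : IsCliffordTImplementable (controlled {a, b} t pauliZ) := by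
    have := (((((((hT a).mul (hT b)).mul (hT t)).mul ((hT' b).diagonal_comp_cnot hab)).mul
      ((hT' t).diagonal_comp_cnot hat)).mul ((hT' t).diagonal_comp_cnot hbt)).mul
        (((hT t).diagonal_comp_cnot hat).diagonal_comp_cnot hbt))
    simp only [diagonal_mul_diagonal, Pi.add_apply, Pi.single_eq_same, Pi.single_eq_of_ne hat,
      add_zero] at this
    rw [pauliZ, controlled_diag]
    simp only [bitPhase_parities] at this
    simpa [and_assoc] using this
  have hH := isCliffordTImplementable_single hadamard_mem_unitaryGroup (by simp) t
  have := (hH.mul hccz).mul hH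
  rw [controlled_empty_mul_controlled_mul _ (by simp [hat.symm, hbt.symm]) hadamard_mul_self,
    hadamard_mul_pauliZ_mul_hadamard] at this
  exact this

/-- An MCX gate as two MCX gates with fewer controls and two Toffoli gates, in alternation: the
dirty ancilla `a` is shifted by the product of the bits `c₁` and `c₂` and back, while the target `t`
is shifted twice under the control of `a` and `B`; the contributions of the initial value of `a`
cancel. -/
lemma mcx_eq_of_dirty {c₁ c₂ a t : Q} {B : Finset Q} (ha₁ : c₁ ≠ a) (ha₂ : c₂ ≠ a) (haB : a ∉ B)
    (ht₁ : c₁ ≠ t) (ht₂ : c₂ ≠ t) (htB : t ∉ B) (hat : a ≠ t) :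
    mcx (insert c₁ (insert c₂ B)) t =
      mcx (insert a B) t * mcx {c₁, c₂} a * (mcx (insert a B) t * mcx {c₁, c₂} a) := by
  simp only [mcx_eq_basisMap, basisMap_mul]
  congr 1
  funext y
  -- The bit strings that occur differ from `y` at `a` and `t` only.
  let z : Fin 2 → Fin 2 → Q → Fin 2 := fun α τ => y + Pi.single a α + Pi.single t τ
  have hz : ∀ α τ q, q ≠ a → q ≠ t → z α τ q = y q := fun α τ q h h' => by simp [z, h, h']
  have hA : ∀ α τ, controlledShift {c₁, c₂} (Pi.single a 1) (z α τ) =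
      z (α + if y c₁ = 1 ∧ y c₂ = 1 then 1 else 0) τ := by
    intro α τ
    simp only [controlledShift, Finset.forall_mem_insert, Finset.mem_singleton, forall_eq,
      hz _ _ _ ha₁ ht₁, hz _ _ _ ha₂ ht₂]
    split_ifs
    · simp only [z, Pi.single_add]
      abel
    · rw [add_zero]
  have hB : ∀ α τ, controlledShift (insert a B) (Pi.single t 1) (z α τ) =
      z α (τ + if y a + α = 1 ∧ ∀ q ∈ B, y q = 1 then 1 else 0) := by
    intro α τ
    have hzB : (∀ q ∈ B, z α τ q = 1) ↔ ∀ q ∈ B, y q = 1 := forall₂_congr fun q hq => by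
      rw [hz _ _ _ (fun e => haB (e ▸ hq)) (fun e => htB (e ▸ hq))]
    have hza : z α τ a = y a + α := by simp [z, hat]
    simp only [controlledShift, Finset.forall_mem_insert, hzB, hza]
    split_ifs
    · simp only [z, Pi.single_add]
      abel
    · rw [add_zero]
  have h0 : y = z 0 0 := by simp [z]
  have hL : controlledShift (insert c₁ (insert c₂ B)) (Pi.single t 1) y =
      z 0 (if y c₁ = 1 ∧ y c₂ = 1 ∧ ∀ q ∈ B, y q = 1 then 1 else 0) := by
    simp only [controlledShift, Finset.forall_mem_insert]
    split_ifs <;> simp [z]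
  rw [hL]
  simp only [Function.comp_apply]
  conv_rhs => rw [h0, hA, hB, hA, hB]
  generalize y a = b
  obtain hβ | hβ := Classical.propComplete (∀ q ∈ B, y q = 1) <;>
    by_cases h₁ : y c₁ = 1 <;> by_cases h₂ : y c₂ = 1 <;>
    simp only [h₁, h₂, hβ, and_true, and_false, if_true, if_false] <;>
    congr 1 <;> revert b <;> decide

/-- An MCX gate with at least two controls on a register with at least one further qubit `a`, by
induction on the number of controls; the qubit `a` may be in any state. -/
theorem isCliffordTImplementable_mcx {C : Finset Q} {a t : Q} (hC : 2 ≤ C.card) (ha : a ∉ C)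
    (ht : t ∉ C) (hat : a ≠ t) : IsCliffordTImplementable (mcx C t) := by
  obtain ⟨k, hk⟩ : ∃ k, C.card = k := ⟨_, rfl⟩
  rw [hk] at hC
  induction k, hC using Nat.le_induction generalizing C a with
  | base =>
    obtain ⟨c₁, c₂, h, rfl⟩ := Finset.card_eq_two.1 hk
    simp only [Finset.mem_insert, Finset.mem_singleton, not_or] at ht
    exact isCliffordTImplementable_ccx h (Ne.symm ht.1) (Ne.symm ht.2)
  | succ k hk2 ih =>
    obtain ⟨c₁, C', h₁, rfl, hC'⟩ := Finset.card_eq_succ.1 hk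
    obtain ⟨c₂, B, h₂, rfl, hB⟩ := Finset.card_eq_succ.1 (hC'.trans (by omega : k = k - 1 + 1))
    simp only [Finset.mem_insert, not_or] at ha ht h₁
    obtain ⟨ha₁, ha₂, haB⟩ := ha
    obtain ⟨ht₁, ht₂, htB⟩ := ht
    obtain ⟨h₁₂, h₁B⟩ := h₁
    rw [mcx_eq_of_dirty (Ne.symm ha₁) (Ne.symm ha₂) haB (Ne.symm ht₁) (Ne.symm ht₂) htB hat]
    -- The first control serves as the dirty ancilla of the smaller gate.
    have h1 : IsCliffordTImplementable (mcx (insert a B) t) := by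
      refine ih (a := c₁) ?_ ?_ (Ne.symm ht₁) ?_
      · simp [Ne.symm ha₁, h₁B]
      · simp [Ne.symm hat, htB]
      · rw [Finset.card_insert_of_notMem haB, hB]
        omega
    have h2 := h1.mul (isCliffordTImplementable_ccx h₁₂ (Ne.symm ha₁) (Ne.symm ha₂))
    exact h2.mul h2

end

end QCircuit

/-! ### Costs and depths of the multi-target circuit -/

namespace QCircuit

lemma Gate.IsCliffordT.map {Q R : Type} {g : Gate Q} (h : g.IsCliffordT) (f : Q ↪ R) :
    (g.map f).IsCliffordT := by
  cases g <;> exact h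

section

variable {n m : ℕ} (hm : 2 ≤ m) (D : Circuit (Fin n ⊕ Fin 2))

lemma isCliffordT_of_mem_multiTarget (hD : ∀ g ∈ D, g.IsCliffordT) :
    ∀ g ∈ multiTarget hm D, g.IsCliffordT := by
  intro g hg
  rcases List.mem_append.1 hg with hg | hg
  · rcases List.mem_append.1 hg with hg | hg
    · exact Or.inl (isCNOT_of_mem_fanOut _ g (List.mem_reverse.1 hg))
    · obtain ⟨g, hgD, rfl⟩ := List.mem_map.1 hg
      exact (hD g hgD).map _
  · exact Or.inl (isCNOT_of_mem_fanOut _ g hg)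

lemma isCNOT_map_iff {Q R : Type} (f : Q ↪ R) (g : Gate Q) : (g.map f).IsCNOT ↔ g.IsCNOT := by
  cases g <;> rfl

lemma isSingleIn_map_iff {Q R : Type} (K : Set (Matrix (Fin 2) (Fin 2) ℂ)) (f : Q ↪ R)
    (g : Gate Q) : (g.map f).IsSingleIn K ↔ g.IsSingleIn K := by
  cases g <;> rfl

lemma Gate.IsCNOT.not_isSingleIn {Q : Type} {g : Gate Q} (h : g.IsCNOT)
    (K : Set (Matrix (Fin 2) (Fin 2) ℂ)) : ¬ g.IsSingleIn K := by
  cases g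
  · exact id
  · exact h.elim

lemma cost_isCNOT_multiTarget :
    Circuit.cost Gate.IsCNOT (multiTarget hm D) = Circuit.cost Gate.IsCNOT D + 2 * (m - 1) := by
  have h1 := cost_isCNOT_fanOut (n := n) (Nat.sub_one_lt_of_lt hm)
  have h2 := Circuit.cost_map (isCNOT_map_iff (place n (firstTwo hm))) D
  simp only [Circuit.cost] at h1 h2
  simp only [multiTarget, Circuit.cost, List.countP_append, List.countP_reverse, h1, h2]
  ring

lemma depth_isCNOT_multiTarget_le :
    Circuit.depth Gate.IsCNOT (multiTarget hm D) ≤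
      Circuit.depth Gate.IsCNOT D + 2 * Nat.clog 2 m := by
  have hlt : m - 1 < m := Nat.sub_one_lt_of_lt hm
  have h1 := depth_fanOut_le (n := n) Gate.IsCNOT hlt
  have h2 := depth_reverse_fanOut_le (n := n) Gate.IsCNOT hlt
  have h3 := Circuit.depth_map (isCNOT_map_iff (place n (firstTwo hm))) D
  have h4 := Circuit.depth_append_le Gate.IsCNOT
    ((fanOut n hlt).reverse ++ D.map (Gate.map (place n (firstTwo hm)))) (fanOut n hlt)
  have h5 := Circuit.depth_append_le Gate.IsCNOT (fanOut n hlt).reverse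
    (D.map (Gate.map (place n (firstTwo hm))))
  rw [multiTarget]
  omega

lemma cost_isSingleIn_multiTarget (K : Set (Matrix (Fin 2) (Fin 2) ℂ)) :
    Circuit.cost (Gate.IsSingleIn K) (multiTarget hm D) = Circuit.cost (Gate.IsSingleIn K) D := by
  rw [multiTarget, Circuit.cost_append_append_of_forall_not,
    Circuit.cost_map (isSingleIn_map_iff K (place n (firstTwo hm)))]
  · exact fun g hg => (isCNOT_of_mem_fanOut _ g (List.mem_reverse.1 hg)).not_isSingleIn K
  · exact fun g hg => (isCNOT_of_mem_fanOut _ g hg).not_isSingleIn K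

lemma depth_isSingleIn_multiTarget (K : Set (Matrix (Fin 2) (Fin 2) ℂ)) :
    Circuit.depth (Gate.IsSingleIn K) (multiTarget hm D) =
      Circuit.depth (Gate.IsSingleIn K) D := by
  rw [multiTarget, Circuit.depth_append_append_of_forall_not,
    Circuit.depth_map (isSingleIn_map_iff K (place n (firstTwo hm)))]
  · exact fun g hg => (isCNOT_of_mem_fanOut _ g (List.mem_reverse.1 hg)).not_isSingleIn K
  · exact fun g hg => (isCNOT_of_mem_fanOut _ g hg).not_isSingleIn K

end

end QCircuit

theorem mainTheorem11 (n m : ℕ) (hn : 5 ≤ n) (hm : 2 ≤ m) :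
    (∃ E : QCircuit.Circuit (Fin n ⊕ Fin m),
      QCircuit.ImplementsMCMTX n m E ∧ ∀ g ∈ E, g.IsCliffordT) ∧
    ∀ D : QCircuit.Circuit (Fin n ⊕ Fin 2), QCircuit.ImplementsMCX n D →
      ∃ E : QCircuit.Circuit (Fin n ⊕ Fin m),
        QCircuit.ImplementsMCMTX n m E ∧
        (∃ (w : Fin 2 ↪ Fin m) (L R : QCircuit.Circuit (Fin n ⊕ Fin m)),
          E = L ++ List.map (QCircuit.Gate.map (QCircuit.place n w)) D ++ R) ∧
        QCircuit.Circuit.cost QCircuit.Gate.IsCNOT E =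
          QCircuit.Circuit.cost QCircuit.Gate.IsCNOT D + 2 * (m - 1) ∧
        QCircuit.Circuit.depth QCircuit.Gate.IsCNOT E ≤
          QCircuit.Circuit.depth QCircuit.Gate.IsCNOT D + 2 * Nat.clog 2 m ∧
        ∀ K : Set (Matrix (Fin 2) (Fin 2) ℂ),
          QCircuit.Circuit.cost (QCircuit.Gate.IsSingleIn K) E =
            QCircuit.Circuit.cost (QCircuit.Gate.IsSingleIn K) D ∧
          QCircuit.Circuit.depth (QCircuit.Gate.IsSingleIn K) E =
            QCircuit.Circuit.depth (QCircuit.Gate.IsSingleIn K) D := by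
  constructor
  · obtain ⟨D, hD, hDK⟩ := QCircuit.isCliffordTImplementable_mcx (C := QCircuit.controls n 2)
      (a := Sum.inr 1) (t := Sum.inr 0)
      (by rw [QCircuit.controls, Finset.card_map, Finset.card_univ, Fintype.card_fin]; omega)
      (QCircuit.inr_notMem_controls 1) (QCircuit.inr_notMem_controls 0) (by simp)
    exact ⟨QCircuit.multiTarget hm D, QCircuit.implementsMCMTX_multiTarget hm hD,
      QCircuit.isCliffordT_of_mem_multiTarget hm D hDK⟩
  · intro D hD
    exact ⟨QCircuit.multiTarget hm D, QCircuit.implementsMCMTX_multiTarget hm hD,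
      ⟨QCircuit.firstTwo hm, _, _, rfl⟩, QCircuit.cost_isCNOT_multiTarget hm D,
      QCircuit.depth_isCNOT_multiTarget_le hm D,
      fun K => ⟨QCircuit.cost_isSingleIn_multiTarget hm D K,
        QCircuit.depth_isSingleIn_multiTarget hm D K⟩⟩
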